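/- Let $\mathfrak A$ be a unital $C^*$-algebra, let $\theta,\alpha$ be $*$-automorphisms of $\mathfrak A$, and let $u\in\mathfrak A$ be a unitary such that $u\,\alpha(\theta(a))=\theta(\alpha(a))\,u$ for all $a\in\mathfrak A$. Let $\mathfrak A\rtimes_\alpha\mathbb Z$ be the crossed product, i.e. the maximal $C^*$-completion of the $*$-algebra of finite sums $\sum_k V^ka_k$ ($a_k\in\mathfrak A$), where $V$ is a unitary with $VaV^*=\alpha(a)$ for $a\in\mathfrak A$, and let $\Phi_{\theta,u}$ be the $*$-automorphism of $\mathfrak A\rtimes_\alpha\mathbb Z$ determined by $\Phi_{\theta,u}(a)=\theta(a)$ for $a\in\mathfrak A$ and $\Phi_{\theta,u}(V)=uV$. Define $u_n\in\mathfrak A$, $n\in\mathbb Z$, by $u_0=I$, $u_n=u\,\alpha(u)\cdots\alpha^{n-1}(u)$ for $n\ge 1$, and $u_n=\alpha^{-1}(u^*)\alpha^{-2}(u^*)\cdots\alpha^{n}(u^*)$ for $n<0$. For $n\in\mathbb Z$ put $$W_n:=\{a\in\mathfrak A\mid \alpha^{-n}(u_n)\,\theta(a)=a\},\qquad S_n:=V^nW_n=\{V^na\mid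 a\in W_n\}\subset\mathfrak A\rtimes_\alpha\mathbb Z .$$ Then: (i) $S_m^*=S_{-m}$ and $S_mS_n\subset S_{m+n}$ for all $m,n\in\mathbb Z$; (ii) the fixed-point algebra $(\mathfrak A\rtimes_\alpha\mathbb Z)^{\Phi_{\theta,u}}=\{x\mid\Phi_{\theta,u}(x)=x\}$ is the norm closure of the linear span of $\bigcup_{n\in\mathbb Z}S_n$; (iii) if $\mathfrak A\neq\{0\}$ and $(\mathfrak A,\theta)$ is topologically ergodic, i.e. $\{a\in\mathfrak A\mid\theta(a)=a\}=\mathbb C I$, then $G_{\theta,u}:=\{n\in\mathbb Z\mid S_n\neq\{0\}\}$ is a subgroup of $\mathbb Z$; (iv) if $(\mathfrak A,\theta)$ is uniquely ergodic, i.e. there is exactly one state $\varphi$ of $\mathfrak A$ with $\varphi\circ\theta=\varphi$, then $(\mathfrak A,\theta)$ is topologically ergodic. -/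

import Mathlib

open scoped ENNReal Pointwise ComplexOrder

universe v

noncomputable section

/-! ### C⋆-dynamical systems given by an automorphism -/

/-- The fixed-point set of a map. For an automorphism `Φ` of a C⋆-algebra it is the fixed-point
subalgebra. -/
def fixedPointSet {B : Type*} (Φ : B → B) : Set B := {x | Φ x = x}

/-- `(A, θ)` is topologically ergodic: the fixed-point subalgebra consists of the scalars. -/
def IsTopologicallyErgodic {A : Type*} [CStarAlgebra A] (θ : A ≃⋆ₐ[ℂ] A) : Prop :=
  fixedPointSet θ = Set.range fun c : ℂ => c • (1 : A)

/-- A state of a unital C⋆-algebra. -/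
def IsState {A : Type*} [CStarAlgebra A] (φ : A →L[ℂ] ℂ) : Prop :=
  (∀ a : A, 0 ≤ φ (star a * a)) ∧ φ 1 = 1

/-- `(A, θ)` is uniquely ergodic: there is exactly one `θ`-invariant state. -/
def IsUniquelyErgodic {A : Type*} [CStarAlgebra A] (θ : A ≃⋆ₐ[ℂ] A) : Prop :=
  ∃! φ : A →L[ℂ] ℂ, IsState φ ∧ ∀ a : A, φ (θ a) = φ a

/-! ### The crossed product of a unital C⋆-algebra by an automorphism -/

/-- A covariant representation of `(A, α)`: a unital ⋆-homomorphism `π` of `A` into a nonzero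
unital C⋆-algebra `C` with a unitary `v` of `C` such that `v π(a) v* = π(α(a))`. Equivalently, a
⋆-homomorphism into `C` of the ⋆-algebra of formal finite sums `∑ Vᵏ aₖ`. -/
structure CovariantRep {A : Type v} [CStarAlgebra A] (α : A ≃⋆ₐ[ℂ] A) : Type (v + 1) where
  C : Type v
  [cstar : CStarAlgebra C]
  [nontriv : Nontrivial C]
  π : A →⋆ₐ[ℂ] C
  v : C
  v_mem : v ∈ unitary C
  covariant : ∀ a : A, v * π a * star v = π (α a)

attribute [instance] CovariantRep.cstar CovariantRep.nontriv

namespace CrossedProduct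

variable {A : Type v} [CStarAlgebra A] (α : A ≃⋆ₐ[ℂ] A)

/-- The `ℓ^∞`-product of the targets of all covariant representations. -/
abbrev Ambient : Type (v + 1) := lp (fun r : CovariantRep α => r.C) ∞

/-- The image of `a` under the direct sum of all covariant representations. -/
def ambientι (a : A) : Ambient α :=
  ⟨fun r => r.π a, memℓp_infty ⟨‖a‖, by
    rintro _ ⟨r, rfl⟩
    exact NonUnitalStarAlgHom.norm_apply_le r.π a⟩⟩

/-- The image of the implementing unitary under the direct sum of all covariant
representations. -/
def ambientV : Ambient α :=
  ⟨fun r => r.v, memℓp_infty ⟨1, by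
    rintro _ ⟨r, rfl⟩
    exact (CStarRing.norm_of_mem_unitary r.v_mem).le⟩⟩

/-- The C⋆-subalgebra of `Ambient α` generated by the images of `A` and of the implementing
unitary. -/
def toSubalgebra : StarSubalgebra ℂ (Ambient α) :=
  (StarAlgebra.adjoin ℂ (Set.range (ambientι α) ∪ {ambientV α})).topologicalClosure

end CrossedProduct

/-- The crossed product `A ⋊_α ℤ`: the completion of the ⋆-algebra of formal finite sums
`∑ Vᵏ aₖ` for the maximal C⋆-norm (the supremum of the norms in all covariant representations),
realised as the closure of the image of that ⋆-algebra under the direct sum of all covariant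
representations. Since `C` may be replaced by the C⋆-subalgebra generated by `π(A)` and `v`, targets
in the universe of `A` suffice. -/
def CrossedProduct {A : Type v} [CStarAlgebra A] (α : A ≃⋆ₐ[ℂ] A) : Type (v + 1) :=
  CrossedProduct.toSubalgebra α

namespace CrossedProduct

section

variable {A : Type v} [CStarAlgebra A] (α : A ≃⋆ₐ[ℂ] A)

instance : CStarAlgebra (Ambient α) where

instance : CStarAlgebra (CrossedProduct α) :=
  StarSubalgebra.cstarAlgebra (toSubalgebra α)
    (h_closed := StarSubalgebra.isClosed_topologicalClosure _)

theorem ambientι_mem (a : A) : ambientι α a ∈ toSubalgebra α :=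
  StarSubalgebra.le_topologicalClosure _ (StarAlgebra.subset_adjoin ℂ _ (Or.inl ⟨a, rfl⟩))

theorem ambientV_mem : ambientV α ∈ toSubalgebra α :=
  StarSubalgebra.le_topologicalClosure _ (StarAlgebra.subset_adjoin ℂ _ (Or.inr rfl))

/-- The canonical ⋆-homomorphism `A → A ⋊_α ℤ`. -/
def ι : A →⋆ₐ[ℂ] CrossedProduct α where
  toFun a := ⟨ambientι α a, ambientι_mem α a⟩
  map_one' := Subtype.ext (lp.ext (funext fun r => map_one r.π))
  map_mul' a b := Subtype.ext (lp.ext (funext fun r => map_mul r.π a b))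
  map_zero' := Subtype.ext (lp.ext (funext fun r => map_zero r.π))
  map_add' a b := Subtype.ext (lp.ext (funext fun r => map_add r.π a b))
  commutes' c := Subtype.ext (lp.ext (funext fun r => r.π.commutes' c))
  map_star' a := Subtype.ext (lp.ext (funext fun r => map_star r.π a))

/-- The implementing unitary `V` of `A ⋊_α ℤ`. -/
def V : unitary (CrossedProduct α) :=
  ⟨⟨ambientV α, ambientV_mem α⟩, Unitary.mem_iff.2
    ⟨Subtype.ext (lp.ext (funext fun r => (Unitary.mem_iff.1 r.v_mem).1)),
      Subtype.ext (lp.ext (funext fun r => (Unitary.mem_iff.1 r.v_mem).2))⟩⟩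

theorem V_mul_ι_mul_star_V (a : A) :
    (V α : CrossedProduct α) * ι α a * star (V α : CrossedProduct α) = ι α (α a) :=
  Subtype.ext (lp.ext (funext fun r => r.covariant a))

end

end CrossedProduct

/-! ### The skew product -/

/-- `u` intertwines `α ∘ θ` and `θ ∘ α`. -/
def Intertwines {A : Type*} [CStarAlgebra A] (α θ : A ≃⋆ₐ[ℂ] A) (u : unitary A) : Prop :=
  ∀ a : A, (u : A) * α (θ a) = θ (α a) * (u : A)

theorem Intertwines.mul_mul_star {A : Type*} [CStarAlgebra A] {α θ : A ≃⋆ₐ[ℂ] A} {u : unitary A}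
    (h : Intertwines α θ u) (a : A) : (u : A) * α (θ a) * star (u : A) = θ (α a) := by
  rw [h a, mul_assoc, (Unitary.mem_iff.1 u.2).2, mul_one]

/-- The unitary `θ⁻¹(u*)`. -/
def symmUnitary {A : Type*} [CStarAlgebra A] (θ : A ≃⋆ₐ[ℂ] A) (u : unitary A) : unitary A :=
  ⟨θ.symm (star (u : A)), by
    rw [Unitary.mem_iff, ← map_star, ← map_mul, ← map_mul]; simp⟩

theorem Intertwines.symm {A : Type*} [CStarAlgebra A] {α θ : A ≃⋆ₐ[ℂ] A} {u : unitary A}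
    (h : Intertwines α θ u) : Intertwines α θ.symm (symmUnitary θ u) := by
  intro a
  apply θ.injective
  have h1 := h (θ.symm a)
  rw [StarAlgEquiv.apply_symm_apply] at h1
  have h2 : star (u : A) * u = 1 := (Unitary.mem_iff.1 u.2).1
  have h3 : (u : A) * star (u : A) = 1 := (Unitary.mem_iff.1 u.2).2
  change θ (θ.symm (star (u : A)) * α (θ.symm a)) = θ (θ.symm (α a) * θ.symm (star (u : A)))
  rw [map_mul, map_mul, StarAlgEquiv.apply_symm_apply, StarAlgEquiv.apply_symm_apply]
  calc star (u : A) * θ (α (θ.symm a))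
      = star (u : A) * (θ (α (θ.symm a)) * u) * star (u : A) := by
        rw [mul_assoc, mul_assoc, h3, mul_one]
    _ = α a * star (u : A) := by rw [← h1, ← mul_assoc, h2, one_mul]

/-- The pull-back `(π ∘ θ, π(u) v)` of a covariant representation `(π, v)`. -/
def CovariantRep.pull {A : Type v} [CStarAlgebra A] {α θ : A ≃⋆ₐ[ℂ] A} {u : unitary A}
    (h : Intertwines α θ u) (r : CovariantRep α) : CovariantRep α where
  C := r.C
  π := r.π.comp (θ : A →⋆ₐ[ℂ] A)
  v := r.π u * r.v
  v_mem := mul_mem (Unitary.map_mem r.π u.2) r.v_mem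
  covariant a := by
    change r.π u * r.v * r.π (θ a) * star (r.π u * r.v) = r.π (θ (α a))
    rw [← h.mul_mul_star a, map_mul, map_mul, ← r.covariant, star_mul, map_star]
    simp only [mul_assoc]

theorem CovariantRep.apply_eq {A : Type v} [CStarAlgebra A] {α : A ≃⋆ₐ[ℂ] A}
    (x : CrossedProduct.Ambient α) (r : CovariantRep α) (π : A →⋆ₐ[ℂ] r.C) (v : r.C)
    (hv : v ∈ unitary r.C) (hc : ∀ a : A, v * π a * star v = π (α a)) (hπ : π = r.π)
    (hvr : v = r.v) : x ⟨r.C, π, v, hv, hc⟩ = x r := by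
  subst hπ hvr
  rfl

theorem CovariantRep.pull_pull_symm {A : Type v} [CStarAlgebra A] {α θ : A ≃⋆ₐ[ℂ] A}
    {u : unitary A} (h : Intertwines α θ u) (r : CovariantRep α)
    (x : CrossedProduct.Ambient α) : x ((r.pull h.symm).pull h) = x r := by
  refine CovariantRep.apply_eq x r _ _ _ _ (StarAlgHom.ext fun a => ?_) ?_
  · change r.π (θ.symm (θ a)) = r.π a
    rw [StarAlgEquiv.symm_apply_apply]
  · change r.π (θ.symm (u : A)) * (r.π (θ.symm (star (u : A))) * r.v) = r.v
    rw [← mul_assoc, ← map_mul, ← map_mul, (Unitary.mem_iff.1 u.2).2, map_one, map_one, one_mul]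

theorem CovariantRep.pull_symm_pull {A : Type v} [CStarAlgebra A] {α θ : A ≃⋆ₐ[ℂ] A}
    {u : unitary A} (h : Intertwines α θ u) (r : CovariantRep α)
    (x : CrossedProduct.Ambient α) : x ((r.pull h).pull h.symm) = x r := by
  refine CovariantRep.apply_eq x r _ _ _ _ (StarAlgHom.ext fun a => ?_) ?_
  · change r.π (θ (θ.symm a)) = r.π a
    rw [StarAlgEquiv.apply_symm_apply]
  · change r.π (θ (θ.symm (star (u : A)))) * (r.π u * r.v) = r.v
    rw [StarAlgEquiv.apply_symm_apply, ← mul_assoc, ← map_mul, (Unitary.mem_iff.1 u.2).1, map_one,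
      one_mul]

namespace CrossedProduct

section

variable {A : Type v} [CStarAlgebra A] {α θ : A ≃⋆ₐ[ℂ] A} {u : unitary A}

/-- Pull-back of covariant representations, as a ⋆-homomorphism of `Ambient α`. -/
def ambientPull (h : Intertwines α θ u) : Ambient α →⋆ₐ[ℂ] Ambient α where
  toFun x := ⟨fun r => x (r.pull h), memℓp_infty ⟨‖x‖, by
    rintro _ ⟨r, rfl⟩
    exact lp.norm_apply_le_norm ENNReal.top_ne_zero x (r.pull h)⟩⟩
  map_one' := rfl
  map_mul' _ _ := rfl
  map_zero' := rfl
  map_add' _ _ := rfl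
  commutes' _ := rfl
  map_star' _ := rfl

theorem continuous_ambientPull (h : Intertwines α θ u) : Continuous (ambientPull h) :=
  AddMonoidHomClass.continuous_of_bound (ambientPull h) 1 fun x => by
    rw [one_mul]
    exact lp.norm_le_of_forall_le (norm_nonneg x) fun r =>
      lp.norm_apply_le_norm ENNReal.top_ne_zero x (r.pull h)

theorem ambientPull_ι (h : Intertwines α θ u) (a : A) :
    ambientPull h (ambientι α a) = ambientι α (θ a) := rfl

theorem ambientPull_V (h : Intertwines α θ u) :
    ambientPull h (ambientV α) = ambientι α u * ambientV α := rfl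

theorem ambientPull_mem (h : Intertwines α θ u) (x : Ambient α) (hx : x ∈ toSubalgebra α) :
    ambientPull h x ∈ toSubalgebra α := by
  have key : (toSubalgebra α).map (ambientPull h) ≤ toSubalgebra α := by
    refine (StarSubalgebra.map_topologicalClosure_le _ _ (continuous_ambientPull h)).trans ?_
    refine StarSubalgebra.topologicalClosure_minimal ?_
      (StarSubalgebra.isClosed_topologicalClosure _)
    rw [StarAlgHom.map_adjoin]
    refine StarAlgebra.adjoin_le ?_
    rintro _ ⟨y, ⟨a, rfl⟩ | rfl, rfl⟩
    · exact ambientι_mem α (θ a)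
    · exact mul_mem (ambientι_mem α u) (ambientV_mem α)
  exact key ⟨x, hx, rfl⟩

/-- The ⋆-endomorphism of `A ⋊_α ℤ` with `a ↦ θ(a)` and `V ↦ u V`. -/
def skewHom (h : Intertwines α θ u) : CrossedProduct α →⋆ₐ[ℂ] CrossedProduct α :=
  ((ambientPull h).comp (toSubalgebra α).subtype).codRestrict (toSubalgebra α)
    fun x => ambientPull_mem h x x.2

/-- The automorphism `Φ` of `A ⋊_α ℤ` with `Φ(a) = θ(a)` and `Φ(V) = u V`. Its inverse has
`a ↦ θ⁻¹(a)` and `V ↦ θ⁻¹(u*) V`. -/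
def skewProduct (h : Intertwines α θ u) : CrossedProduct α ≃⋆ₐ[ℂ] CrossedProduct α :=
  StarAlgEquiv.ofStarAlgHom (skewHom h) (skewHom h.symm)
    (StarAlgHom.ext fun x => Subtype.ext (lp.ext (funext fun r => r.pull_pull_symm h x.1)))
    (StarAlgHom.ext fun x => Subtype.ext (lp.ext (funext fun r => r.pull_symm_pull h x.1)))

theorem skewProduct_ι (h : Intertwines α θ u) (a : A) :
    skewProduct h (ι α a) = ι α (θ a) := rfl

theorem skewProduct_V (h : Intertwines α θ u) :
    skewProduct h (V α : CrossedProduct α) = ι α u * (V α : CrossedProduct α) := rfl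

end

end CrossedProduct

/-! ### Cohomological equations -/

section

variable {A : Type v} [CStarAlgebra A]

/-- The unitaries `u_n` with `(uV)ⁿ = u_n Vⁿ`: `u_n = u α(u) ⋯ αⁿ⁻¹(u)` for `n ≥ 0` and
`u_n = α⁻¹(u*) α⁻²(u*) ⋯ αⁿ(u*)` for `n < 0`. -/
def cocycle (α : A ≃⋆ₐ[ℂ] A) (u : unitary A) : ℤ → A
  | .ofNat n => ((List.range n).map fun k : ℕ => (α ^ (k : ℤ)) (u : A)).prod
  | .negSucc n => ((List.range (n + 1)).map fun k : ℕ => (α ^ (-(k + 1 : ℤ))) (star (u : A))).prod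

/-- The solutions `a` of the cohomological equation `α⁻ⁿ(u_n) θ(a) = a`. -/
def cohomologicalSolutions (α θ : A ≃⋆ₐ[ℂ] A) (u : unitary A) (n : ℤ) : Set A :=
  {a | (α ^ (-n)) (cocycle α u n) * θ a = a}

/-- `S_n = Vⁿ W_n`, where `W_n` is the set of solutions of the cohomological equation. -/
def solutionSpace (α θ : A ≃⋆ₐ[ℂ] A) (u : unitary A) (n : ℤ) : Set (CrossedProduct α) :=
  (fun a => ((CrossedProduct.V α ^ n : unitary (CrossedProduct α)) : CrossedProduct α) *
    CrossedProduct.ι α a) '' cohomologicalSolutions α θ u n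

end

end

/-! ### States from contractive functionals -/

section State

variable {A : Type*} [CStarAlgebra A]

/-! The computation behind the first three parts is `Φ(Vⁿa) = Vⁿ α⁻ⁿ(u_n) θ(a)`. Since `a ↦ Vⁿa` is
injective, `S_n` is exactly the set of fixed points of `Φ` in `VⁿA` (`solutionSpace_eq`), and (i)
follows because `Φ` is a ⋆-homomorphism and the spaces `VⁿA` multiply and star like a grading.
Injectivity needs a faithful copy of `A` in the crossed product (`ι_injective`), supplied by regular
representations induced from GNS representations.

For (ii), the circle acts by the dual action `Vⁿa ↦ zⁿVⁿa`, which commutes with `Φ`. The Fourier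
coefficients of the orbit of `x` are its spectral components; the `k`-th lies in `VᵏA`, and is fixed
by `Φ` when `x` is, hence lies in `S_k`. A continuous function whose Fourier coefficients lie in a
closed subspace takes its values there (`mem_of_fourierCoeff_mem`), so `x`, the value at `0`, lies
in the closed span of the `S_k`.

For (iii), ergodicity says that `S_0` is the scalars, so a nonzero `x ∈ S_n` has `x*x` a nonzero
scalar; multiplication by `x` then kills nothing, and the degrees `n` that occur are closed under
addition.

For (iv), a spectral value of a self-adjoint fixed point `a` is the value at `a` of some state;
averaging over `θ` makes the state invariant without changing that value. Uniqueness leaves one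
spectral value, so `a` is a scalar. -/

theorem im_apply_eq_zero_of_norm_le_one {φ : A →L[ℂ] ℂ} (hφ : ‖φ‖ ≤ 1) (h1 : φ 1 = 1) {b : A}
    (hb : IsSelfAdjoint b) : (φ b).im = 0 := by
  -- Compare `|φ(b + is)|² ≤ ‖b + is‖² ≤ ‖b‖² + s²` with the expansion of the left side: the `s²`
  -- cancel, leaving a bound linear in `s`.
  have key : ∀ s : ℝ, 2 * s * (φ b).im ≤ ‖b‖ ^ 2 := by
    intro s
    set c : A := b + ((s : ℂ) * Complex.I) • 1 with hc
    have hφc : φ c = φ b + s * Complex.I := by simp [hc, h1]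
    have hcc : star c * c = b * b + ((s : ℂ) ^ 2) • 1 := by
      have : star c = b - ((s : ℂ) * Complex.I) • 1 := by
        simp [hc, hb.star_eq, sub_eq_add_neg]
      rw [this, hc, sub_mul, mul_add, mul_add]
      simp only [Algebra.mul_smul_comm, mul_one, Algebra.smul_mul_assoc, one_mul, smul_smul]
      have : (s : ℂ) * Complex.I * (s * Complex.I) = -(s : ℂ) ^ 2 := by
        linear_combination (s : ℂ) ^ 2 * Complex.I_sq
      rw [this, neg_smul]
      abel
    have hn1 : ‖(1 : A)‖ ≤ 1 := by
      nontriviality A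
      simp
    have hle : ‖c‖ * ‖c‖ ≤ ‖b‖ ^ 2 + s ^ 2 := by
      rw [← CStarRing.norm_star_mul_self, hcc]
      refine (norm_add_le _ _).trans (add_le_add ?_ ?_)
      · exact (norm_mul_le b b).trans_eq (sq _).symm
      · rw [norm_smul, norm_pow, Complex.norm_real, Real.norm_eq_abs, sq_abs]
        exact mul_le_of_le_one_right (sq_nonneg s) hn1
    have h2 : ‖φ c‖ ≤ ‖c‖ := (φ.le_of_opNorm_le hφ c).trans_eq (one_mul _)
    have h3 : ‖φ c‖ * ‖φ c‖ = (φ b).re ^ 2 + ((φ b).im + s) ^ 2 := by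
      rw [hφc, ← sq, Complex.sq_norm, Complex.normSq_apply]
      simp [sq]
    nlinarith [norm_nonneg (φ c), sq_nonneg (φ b).re, sq_nonneg (φ b).im]
  by_contra hne
  -- This `s` makes the left side of `key` equal to `‖b‖² + 1`.
  have h := key ((‖b‖ ^ 2 + 1) / (2 * (φ b).im))
  have : 2 * ((‖b‖ ^ 2 + 1) / (2 * (φ b).im)) * (φ b).im = ‖b‖ ^ 2 + 1 := by
    field_simp
  linarith

theorem isState_of_norm_le_one {φ : A →L[ℂ] ℂ} (hφ : ‖φ‖ ≤ 1) (h1 : φ 1 = 1) : IsState φ := by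
  refine ⟨fun a => ?_, h1⟩
  let _ := CStarAlgebra.spectralOrder A
  have := CStarAlgebra.spectralOrderedRing A
  have hb : IsSelfAdjoint (star a * a) := .star_mul_self a
  have h0 : 0 ≤ star a * a := star_mul_self_nonneg a
  set b := star a * a with hbdef
  have him := im_apply_eq_zero_of_norm_le_one hφ h1 hb
  -- For `b ≥ 0` the element `‖b‖ - b` has norm at most `‖b‖`; applying `φ` forces `Re φ(b) ≥ 0`.
  have hnorm : ‖algebraMap ℝ A ‖b‖ - b‖ ≤ ‖b‖ := by
    have := (SpectrumRestricts.nnreal_iff_nnnorm hb (le_refl ‖b‖₊)).1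
      (SpectrumRestricts.nnreal_of_nonneg h0)
    exact_mod_cast this
  have h2 : ‖φ (algebraMap ℝ A ‖b‖ - b)‖ ≤ ‖b‖ :=
    ((φ.le_of_opNorm_le hφ _).trans_eq (one_mul _)).trans hnorm
  have h3 : φ (algebraMap ℝ A ‖b‖ - b) = ‖b‖ - φ b := by
    rw [map_sub, Algebra.algebraMap_eq_smul_one, ← Complex.coe_smul, map_smul, h1, smul_eq_mul,
      mul_one]
  rw [h3] at h2
  have h4 := (Complex.abs_re_le_norm _).trans h2
  rw [Complex.sub_re, Complex.ofReal_re] at h4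
  rw [Complex.le_def]
  exact ⟨by simpa using (abs_le.1 h4).2, him.symm⟩

/-- A spectral value of a normal element is attained by a functional of norm at most one. -/
theorem exists_norm_le_one_apply_eq (a : A) [IsStarNormal a] {z : ℂ} (hz : z ∈ spectrum ℂ a) :
    ∃ φ : A →L[ℂ] ℂ, ‖φ‖ ≤ 1 ∧ φ 1 = 1 ∧ φ a = z := by
  -- Evaluation at `z`, carried to the C⋆-algebra generated by `a` through the functional calculus,
  -- then extended by Hahn–Banach.
  let χ : StarAlgebra.elemental ℂ a →⋆ₐ[ℂ] ℂ :=
    (ContinuousMap.evalStarAlgHom ℂ ℂ (⟨z, hz⟩ : spectrum ℂ a)).comp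
      ((continuousFunctionalCalculus a).symm : _ →⋆ₐ[ℂ] C(spectrum ℂ a, ℂ))
  let f : StrongDual ℂ (Subalgebra.toSubmodule (StarAlgebra.elemental ℂ a).toSubalgebra) :=
    LinearMap.mkContinuous
      { toFun := fun x => χ x
        map_add' := fun x y => map_add χ x y
        map_smul' := fun c x => map_smul χ c x } 1 fun x => by
      rw [one_mul]
      exact NonUnitalStarAlgHom.norm_apply_le χ (show StarAlgebra.elemental ℂ a from x)
  obtain ⟨g, hg, hgn⟩ := exists_extension_norm_eq _ f
  refine ⟨g, hgn.trans_le (LinearMap.mkContinuous_norm_le _ zero_le_one _), ?_, ?_⟩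
  · exact (hg ⟨1, one_mem (StarAlgebra.elemental ℂ a)⟩).trans (map_one χ)
  · refine (hg ⟨a, StarAlgebra.elemental.self_mem ℂ a⟩).trans ?_
    change (continuousFunctionalCalculus a).symm ⟨a, _⟩ ⟨z, hz⟩ = z
    have := continuousFunctionalCalculus_map_id a
    rw [← this, StarAlgEquiv.symm_apply_apply]
    rfl

end State

/-! ### Averaging and unique ergodicity -/

section Ergodic

open Filter Topology

variable {A : Type*} [CStarAlgebra A]

/-- The weak-⋆ limit points of the Cesàro means of a functional of norm at most one. -/
theorem exists_invariant_of_norm_le_one (θ : A ≃⋆ₐ[ℂ] A) {φ : A →L[ℂ] ℂ} (hφ : ‖φ‖ ≤ 1) :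
    ∃ ψ : A →L[ℂ] ℂ, ‖ψ‖ ≤ 1 ∧ (∀ a, ψ (θ a) = ψ a) ∧ ∀ a, θ a = a → ψ a = φ a := by
  let T : A →L[ℂ] A := LinearMap.mkContinuous (θ : A →ₗ[ℂ] A) 1 fun x => by
    rw [one_mul]
    exact (StarAlgEquiv.norm_map θ x).le
  have hT : ∀ x, T x = θ x := fun x => rfl
  have hTn : ∀ (k : ℕ) (x : A), ‖(T ^ k) x‖ ≤ ‖x‖ := by
    intro k
    induction k with
    | zero => intro x; simp
    | succ k ih =>
      intro x
      rw [pow_succ, mul_apply_eq_comp]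
      exact (ih _).trans_eq (StarAlgEquiv.norm_map θ x)
  let S : ℕ → A →L[ℂ] ℂ := fun n => ((n + 1 : ℂ)⁻¹) • ∑ k ∈ Finset.range (n + 1), φ.comp (T ^ k)
  have hSapp : ∀ n x, S n x = ((n + 1 : ℂ)⁻¹) * ∑ k ∈ Finset.range (n + 1), φ ((T ^ k) x) := by
    intro n x
    simp [S]
  have hn0 : ∀ n : ℕ, (n + 1 : ℂ) ≠ 0 := fun n => by exact_mod_cast n.succ_ne_zero
  have hnn : ∀ n : ℕ, ‖(n + 1 : ℂ)‖ = n + 1 := fun n => by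
    rw [← Nat.cast_succ, Complex.norm_natCast, Nat.cast_succ]
  have hφx : ∀ x, ‖φ x‖ ≤ ‖x‖ := fun x => (φ.le_of_opNorm_le hφ x).trans_eq (one_mul _)
  have hS : ∀ n, ‖S n‖ ≤ 1 := by
    intro n
    refine ContinuousLinearMap.opNorm_le_bound _ zero_le_one fun x => ?_
    rw [one_mul, hSapp, norm_mul, norm_inv, hnn]
    have : ‖∑ k ∈ Finset.range (n + 1), φ ((T ^ k) x)‖ ≤ (n + 1) * ‖x‖ := by
      refine (norm_sum_le_of_le _ fun k _ => (hφx _).trans (hTn k x)).trans_eq ?_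
      simp
    rw [inv_mul_le_iff₀ (by positivity)]
    exact this
  have hcpt := WeakDual.isCompact_closedBall (𝕜 := ℂ) (E := A) 0 1
  let F : ℕ → WeakDual ℂ A := fun n => StrongDual.toWeakDual (S n)
  -- Banach–Alaoglu. The dual ball need not be metrizable, so the limit is taken along a free
  -- ultrafilter and not along a subsequence.
  obtain ⟨ψ, hψ, hlim⟩ := hcpt.ultrafilter_le_nhds ((hyperfilter ℕ).map F) (by
    rw [le_principal_iff]
    refine Ultrafilter.mem_map.2 (Filter.univ_mem' fun n => ?_)
    have := hS n
    simpa [F] using this)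
  have hlim' : Tendsto F (hyperfilter ℕ) (𝓝 ψ) := hlim
  have hev : ∀ x, Tendsto (fun n => S n x) (hyperfilter ℕ) (𝓝 (ψ x)) := fun x =>
    ((WeakDual.eval_continuous x).tendsto ψ).comp hlim'
  refine ⟨WeakDual.toStrongDual ψ, by simpa using hψ, fun a => ?_, fun a ha => ?_⟩
  · change ψ (θ a) = ψ a
    have h1 : Tendsto (fun n => S n (θ a) - S n a) (hyperfilter ℕ) (𝓝 0) := by
      refine Tendsto.mono_left ?_ Nat.hyperfilter_le_atTop
      refine squeeze_zero_norm (a := fun n : ℕ => 2 * ‖a‖ * (1 / ((n : ℝ) + 1))) (fun n => ?_) ?_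
      -- The difference telescopes to two terms, of size at most `2‖a‖ / (n + 1)`.
      · have : S n (θ a) - S n a = ((n + 1 : ℂ)⁻¹) * (φ ((T ^ (n + 1)) a) - φ a) := by
          rw [hSapp, hSapp, ← mul_sub, ← Finset.sum_sub_distrib]
          congr 1
          have := Finset.sum_range_sub (fun k => φ ((T ^ k) a)) (n + 1)
          simpa [pow_succ, hT] using this
        rw [this, norm_mul, norm_inv, hnn, one_div, mul_comm]
        refine mul_le_mul_of_nonneg_right ?_ (by positivity)
        refine (norm_sub_le _ _).trans ?_
        linarith [(hφx ((T ^ (n + 1)) a)).trans (hTn _ a), hφx a]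
      · simpa using (tendsto_one_div_add_atTop_nhds_zero_nat (𝕜 := ℝ)).const_mul (2 * ‖a‖)
    exact sub_eq_zero.1 (tendsto_nhds_unique ((hev (θ a)).sub (hev a)) h1)
  · change ψ a = φ a
    have hk : ∀ k, (T ^ k) a = a := by
      intro k
      induction k with
      | zero => simp
      | succ k ih => rw [pow_succ, mul_apply_eq_comp, hT, ha, ih]
    refine tendsto_nhds_unique (hev a) ?_
    refine tendsto_const_nhds.congr fun n => ?_
    rw [hSapp]
    simp only [hk, Finset.sum_const, Finset.card_range, nsmul_eq_mul, Nat.cast_succ]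
    rw [inv_mul_cancel_left₀ (hn0 n)]

theorem IsUniquelyErgodic.isTopologicallyErgodic {θ : A ≃⋆ₐ[ℂ] A} (h : IsUniquelyErgodic θ) :
    IsTopologicallyErgodic θ := by
  obtain ⟨φ₀, ⟨hφ₀, -⟩, huniq⟩ := h
  have : Nontrivial A := by
    by_contra hA
    rw [not_nontrivial_iff_subsingleton] at hA
    have := hφ₀.2
    rw [Subsingleton.elim (1 : A) 0, map_zero] at this
    exact zero_ne_one this
  have hval : ∀ a : A, IsSelfAdjoint a → θ a = a → ∀ z ∈ spectrum ℂ a, z = φ₀ a := by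
    intro a ha hfix z hz
    have := ha.isStarNormal
    obtain ⟨φ, hφ, hφ1, hφa⟩ := exists_norm_le_one_apply_eq a hz
    obtain ⟨ψ, hψ, hinv, hψeq⟩ := exists_invariant_of_norm_le_one θ hφ
    have := huniq ψ ⟨isState_of_norm_le_one hψ (by rw [hψeq 1 (map_one θ), hφ1]), hinv⟩
    rw [← this, hψeq a hfix, hφa]
  have hsa : ∀ a : A, IsSelfAdjoint a → θ a = a → a = φ₀ a • (1 : A) := by
    intro a ha hfix
    have := ha.isStarNormal
    rw [← Algebra.algebraMap_eq_smul_one]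
    exact CFC.eq_algebraMap_of_spectrum_subset_singleton a _ fun z hz => hval a ha hfix z hz
  refine Set.Subset.antisymm (fun x hx => ?_) ?_
  · have hx' : θ x = x := hx
    have hre : θ (realPart x : A) = realPart x := by
      rw [realPart_apply_coe, ← Complex.coe_smul, map_smul, map_add, map_star, hx']
    have him : θ (imaginaryPart x : A) = imaginaryPart x := by
      rw [imaginaryPart_apply_coe, ← Complex.coe_smul, map_smul, map_smul, map_sub, map_star, hx']
    refine ⟨φ₀ (realPart x : A) + Complex.I * φ₀ (imaginaryPart x : A), ?_⟩
    change (φ₀ (realPart x : A) + Complex.I * φ₀ (imaginaryPart x : A)) • (1 : A) = x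
    rw [add_smul, mul_smul, ← hsa _ (realPart x).2 hre, ← hsa _ (imaginaryPart x).2 him]
    exact realPart_add_I_smul_imaginaryPart x
  · rintro _ ⟨c, rfl⟩
    change θ (c • 1) = c • 1
    rw [map_smul, map_one]

end Ergodic

/-! ### Regular representations and faithfulness of `A` in the crossed product -/

section Regular

open scoped InnerProductSpace

/-- Reindexing of an `ℓ²`-space by a permutation of the index set. -/
noncomputable def lpReindex {I H : Type*} [NormedAddCommGroup H] [InnerProductSpace ℂ H]
    (e : I ≃ I) :
    lp (fun _ : I => H) 2 ≃ₗᵢ[ℂ] lp (fun _ : I => H) 2 where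
  toFun f := ⟨fun i => f (e i), (memℓp_gen_iff (by norm_num)).2
    ((e.summable_iff (f := fun i => ‖f i‖ ^ (2 : ℝ≥0∞).toReal)).2
      ((lp.memℓp f).summable (by norm_num)))⟩
  invFun f := ⟨fun i => f (e.symm i), (memℓp_gen_iff (by norm_num)).2
    ((e.symm.summable_iff (f := fun i => ‖f i‖ ^ (2 : ℝ≥0∞).toReal)).2
      ((lp.memℓp f).summable (by norm_num)))⟩
  map_add' _ _ := rfl
  map_smul' _ _ := rfl
  left_inv f := lp.ext (funext fun i => congrArg f (e.apply_symm_apply i))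
  right_inv f := lp.ext (funext fun i => congrArg f (e.symm_apply_apply i))
  norm_map' f := by
    rw [lp.norm_eq_tsum_rpow (by norm_num), lp.norm_eq_tsum_rpow (by norm_num)]
    congr 1
    exact e.tsum_eq fun i => ‖f i‖ ^ (2 : ℝ≥0∞).toReal

variable {A : Type v} [CStarAlgebra A] {H : Type v} [NormedAddCommGroup H] [InnerProductSpace ℂ H]
  [CompleteSpace H]

/-- The diagonal part `(π(a) ξ)(n) = ρ(α⁻ⁿ(a)) ξ(n)` of the regular representation induced
by `ρ`. -/
noncomputable def regularHom (α : A ≃⋆ₐ[ℂ] A) (ρ : A →⋆ₐ[ℂ] (H →L[ℂ] H)) :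
    A →⋆ₐ[ℂ] (lp (fun _ : ℤ => H) 2 →L[ℂ] lp (fun _ : ℤ => H) 2) where
  toFun a := lp.mapCLM 2 (fun n : ℤ => ρ ((α ^ (-n)) a)) (norm_nonneg a) fun n =>
    (NonUnitalStarAlgHom.norm_apply_le ρ _).trans_eq (StarAlgEquiv.norm_map _ a)
  map_one' := by
    ext f n
    simp
  map_mul' a b := by
    ext f n
    simp
  map_zero' := by
    ext f n
    simp
  map_add' a b := by
    ext f n
    simp
  commutes' c := by
    ext f n
    simp [Algebra.algebraMap_eq_smul_one]
  map_star' a := by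
    rw [ContinuousLinearMap.star_eq_adjoint, ContinuousLinearMap.eq_adjoint_iff]
    intro f g
    rw [lp.inner_eq_tsum, lp.inner_eq_tsum]
    refine tsum_congr fun n => ?_
    simp only [lp.mapCLM_apply_coe, map_star, ContinuousLinearMap.star_eq_adjoint,
      ContinuousLinearMap.adjoint_inner_left]

/-- The regular covariant representation induced by a representation on a Hilbert space. -/
noncomputable def regularRep (α : A ≃⋆ₐ[ℂ] A) (ρ : A →⋆ₐ[ℂ] (H →L[ℂ] H)) [Nontrivial H] :
    CovariantRep α where
  C := lp (fun _ : ℤ => H) 2 →L[ℂ] lp (fun _ : ℤ => H) 2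
  nontriv := by
    have : Nontrivial (lp (fun _ : ℤ => H) 2) := by
      obtain ⟨x, hx⟩ := exists_ne (0 : H)
      refine ⟨lp.single 2 0 x, 0, fun h => hx ?_⟩
      have := congrArg (fun f : lp (fun _ : ℤ => H) 2 => f 0) h
      simpa using this
    infer_instance
  π := regularHom α ρ
  v := (Unitary.linearIsometryEquiv.symm (lpReindex (H := H) (Equiv.subRight (1 : ℤ))) :)
  v_mem := Subtype.property _
  covariant a := by
    set w := Unitary.linearIsometryEquiv.symm (lpReindex (H := H) (Equiv.subRight (1 : ℤ))) with hw
    have key : (w : lp (fun _ : ℤ => H) 2 →L[ℂ] lp (fun _ : ℤ => H) 2) * regularHom α ρ a =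
        regularHom α ρ (α a) * w := by
      ext f n
      -- The unitary is the shift `(wf)(n) = f(n - 1)`, so covariance reduces to `α^(-(n-1)) = α⁻ⁿ ∘
      -- α`.
      change ρ ((α ^ (-(n - 1))) a) (f (n - 1)) = ρ ((α ^ (-n)) (α a)) (f (n - 1))
      rw [neg_sub', sub_neg_eq_add, zpow_add_one, StarAlgEquiv.mul_apply]
    rw [key, mul_assoc, (Unitary.mem_iff.1 w.2).2, mul_one]

/-- A nonzero spectral value of `a*a` is attained by a state; in its GNS representation the vector
`ξ` of `1` satisfies `‖ρ(a)ξ‖² = φ(a*a) ≠ 0`. -/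
theorem exists_rep_apply_ne_zero {a : A} (ha : a ≠ 0) :
    ∃ (H : Type v) (_ : NormedAddCommGroup H) (_ : InnerProductSpace ℂ H) (_ : CompleteSpace H)
      (ρ : A →⋆ₐ[ℂ] (H →L[ℂ] H)), ρ a ≠ 0 := by
  have hsa : IsSelfAdjoint (star a * a) := .star_mul_self a
  have hn := hsa.isStarNormal
  have hne : star a * a ≠ 0 := fun h => ha (CStarRing.star_mul_self_eq_zero_iff a |>.1 h)
  obtain ⟨z, hz, hz0⟩ : ∃ z ∈ spectrum ℂ (star a * a), z ≠ 0 := by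
    by_contra! h
    exact hne (CFC.eq_zero_of_spectrum_subset_zero (R := ℂ) _ fun z hz => h z hz)
  obtain ⟨φ, hφ, h1, hz'⟩ := exists_norm_le_one_apply_eq _ hz
  have hst := isState_of_norm_le_one hφ h1
  let _ := CStarAlgebra.spectralOrder A
  have := CStarAlgebra.spectralOrderedRing A
  let f : A →ₚ[ℂ] ℂ := PositiveLinearMap.mk₀ (φ : A →ₗ[ℂ] ℂ) fun x hx => by
    obtain ⟨b, rfl⟩ := CStarAlgebra.nonneg_iff_eq_star_mul_self.1 hx
    exact hst.1 b
  refine ⟨f.GNS, inferInstance, inferInstance, inferInstance, f.gnsStarAlgHom, fun h => hz0 ?_⟩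
  have h2 : f.gnsStarAlgHom a ((f.toPreGNS 1 : f.PreGNS) : f.GNS) = 0 := by rw [h]; rfl
  have h3 : f.gnsNonUnitalStarAlgHom a ((f.toPreGNS 1 : f.PreGNS) : f.GNS) = 0 := h2
  rw [PositiveLinearMap.gnsNonUnitalStarAlgHom_apply_coe, PositiveLinearMap.leftMulMapPreGNS_apply]
    at h3
  have h4 := congrArg norm h3
  rw [UniformSpace.Completion.norm_coe, norm_zero, PositiveLinearMap.ofPreGNS_toPreGNS,
    mul_one] at h4
  have h5 := f.preGNS_norm_sq (f.toPreGNS a)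
  rw [h4, PositiveLinearMap.ofPreGNS_toPreGNS] at h5
  rw [← hz']
  change f (star a * a) = 0
  simpa using h5.symm

namespace CrossedProduct

theorem ι_injective (α : A ≃⋆ₐ[ℂ] A) : Function.Injective (ι α) := by
  rw [injective_iff_map_eq_zero]
  intro a h
  by_contra ha
  obtain ⟨H, _, _, _, ρ, hρ⟩ := exists_rep_apply_ne_zero ha
  obtain ⟨x, hx⟩ : ∃ x, ρ a x ≠ 0 := by
    by_contra! h0
    exact hρ (ContinuousLinearMap.ext h0)
  have : Nontrivial H := ⟨_, _, hx⟩
  -- Elements of the crossed product are families over all covariant representations; read off the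
  -- regular coordinate, then test it on `x` placed at site `0`, where the twist `α⁻⁰` is trivial.
  have h1 : regularHom α ρ a = 0 :=
    congrArg (fun y : CrossedProduct α => (y.1 : ∀ r, _) (regularRep α ρ)) h
  have h2 := congrArg (fun T => T (lp.single 2 0 x) 0) h1
  apply hx
  have h3 : ρ ((α ^ (-0 : ℤ)) a) ((lp.single 2 0 x : lp (fun _ : ℤ => H) 2) 0) = 0 := h2
  simpa using h3

end CrossedProduct

end Regular

/-! ### The monomials `Vⁿa` -/

theorem mul_left_injective_of_unitary {B : Type*} [CStarAlgebra B] (w : unitary B) :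
    Function.Injective fun x : B => x * w := fun x y h => by
  have h1 := congrArg (fun z => z * star (w : B)) h
  simpa only [mul_assoc, (Unitary.mem_iff.1 w.2).2, mul_one] using h1

namespace CrossedProduct

variable {A : Type v} [CStarAlgebra A] (α : A ≃⋆ₐ[ℂ] A)

/-- The element `Vⁿ a` of the crossed product. -/
noncomputable def monomial (n : ℤ) : A →ₗ[ℂ] CrossedProduct α where
  toFun a := ((V α ^ n : unitary (CrossedProduct α)) : CrossedProduct α) * ι α a
  map_add' a b := by rw [map_add, mul_add]
  map_smul' c a := by rw [map_smul, mul_smul_comm, RingHom.id_apply]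

theorem monomial_apply (n : ℤ) (a : A) :
    monomial α n a = ((V α ^ n : unitary (CrossedProduct α)) : CrossedProduct α) * ι α a := rfl

theorem V_mul_ι (a : A) :
    (V α : CrossedProduct α) * ι α a = ι α (α a) * (V α : CrossedProduct α) := by
  rw [← V_mul_ι_mul_star_V, mul_assoc _ _ (V α : CrossedProduct α),
    (Unitary.mem_iff.1 (V α).2).1, mul_one]

theorem V_zpow_mul_ι (n : ℤ) (a : A) :
    ((V α ^ n : unitary (CrossedProduct α)) : CrossedProduct α) * ι α a =
      ι α ((α ^ n) a) * ((V α ^ n : unitary (CrossedProduct α)) : CrossedProduct α) := by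
  induction n generalizing a with
  | zero => simp
  | succ n ih =>
    rw [zpow_add_one, zpow_add_one, Submonoid.coe_mul, mul_assoc, V_mul_ι, ← mul_assoc, ih,
      mul_assoc, StarAlgEquiv.mul_apply]
  | pred n ih =>
    have h1 := ih (α.symm a)
    rw [← sub_add_cancel (-(n : ℤ)) 1, zpow_add_one, zpow_add_one, Submonoid.coe_mul, mul_assoc,
      V_mul_ι, StarAlgEquiv.apply_symm_apply, StarAlgEquiv.mul_apply,
      StarAlgEquiv.apply_symm_apply, ← mul_assoc, ← mul_assoc] at h1
    exact mul_left_injective_of_unitary (V α) h1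

theorem monomial_mul_monomial (m n : ℤ) (a b : A) :
    monomial α m a * monomial α n b = monomial α (m + n) ((α ^ (-n)) a * b) := by
  have h := V_zpow_mul_ι α n ((α ^ (-n)) a)
  rw [← StarAlgEquiv.mul_apply, ← zpow_add, add_neg_cancel, zpow_zero, StarAlgEquiv.one_apply] at h
  simp only [monomial_apply]
  rw [zpow_add, Submonoid.coe_mul, map_mul, mul_assoc, ← mul_assoc (ι α a), ← h]
  simp only [mul_assoc]

theorem star_monomial (n : ℤ) (a : A) :
    star (monomial α n a) = monomial α (-n) ((α ^ n) (star a)) := by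
  rw [monomial_apply, monomial_apply, V_zpow_mul_ι α (-n), ← StarAlgEquiv.mul_apply, ← zpow_add,
    neg_add_cancel, zpow_zero, StarAlgEquiv.one_apply, star_mul, map_star, zpow_neg,
    ← Unitary.star_eq_inv, Unitary.coe_star]

theorem monomial_injective (n : ℤ) : Function.Injective (monomial α n) := by
  intro a b h
  apply ι_injective α
  have h1 := congrArg (fun x => star ((V α ^ n : unitary (CrossedProduct α)) : CrossedProduct α) * x) h
  simp only [monomial_apply, ← mul_assoc] at h1
  rwa [(Unitary.mem_iff.1 (V α ^ n).2).1, one_mul, one_mul] at h1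

theorem norm_monomial (n : ℤ) (a : A) : ‖monomial α n a‖ = ‖a‖ := by
  rw [monomial_apply, CStarRing.norm_coe_unitary_mul]
  exact NonUnitalStarAlgHom.norm_map (ι α) (ι_injective α) a

/-- Closedness lets membership of spectral components in `VⁿA` pass from finite sums to limits. -/
theorem isClosed_range_monomial (n : ℤ) : IsClosed (Set.range (monomial α n)) :=
  (AddMonoidHomClass.isometry_of_norm (monomial α n) (norm_monomial α n)).isClosedEmbedding.isClosed_range

theorem one_eq_monomial : monomial α 0 1 = 1 := by simp [monomial_apply]

/-- The ⋆-algebra of finite sums `∑ Vᵏ aₖ`. -/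
noncomputable def polynomials : StarSubalgebra ℂ (CrossedProduct α) where
  toSubalgebra := (Submodule.span ℂ {x | ∃ n a, monomial α n a = x}).toSubalgebra
    (Submodule.subset_span ⟨0, 1, one_eq_monomial α⟩) fun x y hx hy => by
      induction hx using Submodule.span_induction with
      | mem x hx =>
        obtain ⟨m, a, rfl⟩ := hx
        induction hy using Submodule.span_induction with
        | mem y hy =>
          obtain ⟨n, b, rfl⟩ := hy
          exact Submodule.subset_span ⟨_, _, (monomial_mul_monomial α m n a b).symm⟩
        | zero => rw [mul_zero]; exact zero_mem _
        | add y z _ _ hy hz => rw [mul_add]; exact add_mem hy hz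
        | smul c y _ hy => rw [mul_smul_comm]; exact Submodule.smul_mem _ c hy
      | zero => rw [zero_mul]; exact zero_mem _
      | add x z _ _ hx hz => rw [add_mul]; exact add_mem hx hz
      | smul c x _ hx => rw [smul_mul_assoc]; exact Submodule.smul_mem _ c hx
  star_mem' {x} hx := by
    change star x ∈ Submodule.span ℂ {x | ∃ n a, monomial α n a = x}
    change x ∈ Submodule.span ℂ {x | ∃ n a, monomial α n a = x} at hx
    induction hx using Submodule.span_induction with
    | mem x hx =>
      obtain ⟨m, a, rfl⟩ := hx
      exact Submodule.subset_span ⟨_, _, (star_monomial α m a).symm⟩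
    | zero => rw [star_zero]; exact zero_mem _
    | add x z _ _ hx hz => rw [star_add]; exact add_mem hx hz
    | smul c x _ hx => rw [star_smul]; exact Submodule.smul_mem _ _ hx

theorem mem_closure_span_monomials (x : CrossedProduct α) :
    x ∈ closure (Submodule.span ℂ {x | ∃ n a, monomial α n a = x} : Set (CrossedProduct α)) := by
  have hle : StarAlgebra.adjoin ℂ (Set.range (ambientι α) ∪ {ambientV α}) ≤
      (polynomials α).map (toSubalgebra α).subtype := by
    refine StarAlgebra.adjoin_le ?_
    rintro _ (⟨a, rfl⟩ | rfl)
    · refine ⟨ι α a, Submodule.subset_span ⟨0, a, ?_⟩, rfl⟩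
      simp [monomial_apply]
    · refine ⟨(V α : CrossedProduct α), Submodule.subset_span ⟨1, 1, ?_⟩, rfl⟩
      simp [monomial_apply]
  exact closure_subtype.2 (closure_mono hle x.2)

/-! ### The skew product on monomials, and the grading of its fixed points -/

section Skew

variable {α} {θ : A ≃⋆ₐ[ℂ] A} {u : unitary A}

theorem cocycle_add_one (n : ℤ) : cocycle α u (n + 1) = cocycle α u n * (α ^ n) (u : A) := by
  rcases n with n | n
  · change ((List.range (n + 1)).map fun k : ℕ => (α ^ (k : ℤ)) (u : A)).prod = _
    rw [List.range_succ, List.map_append, List.prod_append]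
    simp [cocycle]
  · have h : (α ^ (Int.negSucc n)) (star (u : A)) * (α ^ (Int.negSucc n)) (u : A) = 1 := by
      rw [← map_mul, (Unitary.mem_iff.1 u.2).1, map_one]
    have h2 : cocycle α u (Int.negSucc n) =
        ((List.range n).map fun k : ℕ => (α ^ (-(k + 1 : ℤ))) (star (u : A))).prod *
          (α ^ (Int.negSucc n)) (star (u : A)) := by
      change ((List.range (n + 1)).map fun k : ℕ => (α ^ (-(k + 1 : ℤ))) (star (u : A))).prod = _
      rw [List.range_succ, List.map_append, List.prod_append]
      simp [Int.negSucc_eq]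
    rw [h2, mul_assoc, h, mul_one]
    -- Adding one to `Int.negSucc 0` leaves the negative branch, hence the split.
    rcases n with n | n
    · rfl
    · rfl

/-- Both sides are multiplied on the right by the unitary `uV` when `n` grows by one, and they agree
at `0`; cancelling `uV` gives the negative powers. -/
theorem skewProduct_V_zpow (h : Intertwines α θ u) (n : ℤ) :
    skewProduct h ((V α ^ n : unitary (CrossedProduct α)) : CrossedProduct α) =
      ι α (cocycle α u n) * ((V α ^ n : unitary (CrossedProduct α)) : CrossedProduct α) := by
  have step : ∀ k : ℤ, skewProduct h ((V α ^ (k + 1) : unitary (CrossedProduct α))) =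
      skewProduct h ((V α ^ k : unitary (CrossedProduct α)) : CrossedProduct α) *
        (ι α u * (V α : CrossedProduct α)) := by
    intro k
    rw [zpow_add_one, Submonoid.coe_mul, map_mul, skewProduct_V]
  have step' : ∀ k : ℤ, ι α (cocycle α u (k + 1)) * ((V α ^ (k + 1) : unitary (CrossedProduct α))) =
      ι α (cocycle α u k) * ((V α ^ k : unitary (CrossedProduct α)) : CrossedProduct α) *
        (ι α u * (V α : CrossedProduct α)) := by
    intro k
    rw [zpow_add_one, Submonoid.coe_mul, cocycle_add_one, map_mul, mul_assoc (ι α (cocycle α u k)),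
      ← mul_assoc (ι α ((α ^ k) (u : A))), ← V_zpow_mul_ι]
    simp only [mul_assoc]
  let W : unitary (CrossedProduct α) := ⟨ι α u, Unitary.map_mem (ι α) u.2⟩ * V α
  induction n with
  | zero => simp [cocycle]
  | succ n ih => rw [step, step', ih]
  | pred n ih =>
    rw [← sub_add_cancel (-(n : ℤ)) 1, step, step'] at ih
    exact mul_left_injective_of_unitary W ih

theorem skewProduct_monomial (h : Intertwines α θ u) (n : ℤ) (a : A) :
    skewProduct h (monomial α n a) = monomial α n ((α ^ (-n)) (cocycle α u n) * θ a) := by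
  have h1 := V_zpow_mul_ι α n ((α ^ (-n)) (cocycle α u n))
  rw [← StarAlgEquiv.mul_apply, ← zpow_add, add_neg_cancel, zpow_zero, StarAlgEquiv.one_apply]
    at h1
  rw [monomial_apply, monomial_apply, map_mul, skewProduct_V_zpow, skewProduct_ι, ← h1, map_mul,
    mul_assoc]

/-- `S_n` consists of the fixed points of `Φ` in `Vⁿ A`. -/
theorem solutionSpace_eq (h : Intertwines α θ u) (n : ℤ) :
    solutionSpace α θ u n = Set.range (monomial α n) ∩ fixedPointSet (skewProduct h) := by
  ext x
  constructor
  · rintro ⟨a, ha, rfl⟩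
    refine ⟨⟨a, rfl⟩, (skewProduct_monomial h n a).trans ?_⟩
    rw [show _ = a from ha, monomial_apply]
  · rintro ⟨⟨a, rfl⟩, hx⟩
    exact ⟨a, monomial_injective α n ((skewProduct_monomial h n a).symm.trans hx), rfl⟩

theorem star_mem_solutionSpace (h : Intertwines α θ u) {n : ℤ} {x : CrossedProduct α}
    (hx : x ∈ solutionSpace α θ u n) : star x ∈ solutionSpace α θ u (-n) := by
  rw [solutionSpace_eq h] at hx ⊢
  obtain ⟨⟨a, rfl⟩, hx⟩ := hx
  exact ⟨⟨_, (star_monomial α n a).symm⟩, (map_star _ _).trans (congrArg star hx)⟩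

theorem star_solutionSpace (h : Intertwines α θ u) (n : ℤ) :
    star (solutionSpace α θ u n) = solutionSpace α θ u (-n) := by
  ext x
  rw [Set.mem_star]
  constructor <;> intro hx
  · simpa using star_mem_solutionSpace h hx
  · simpa using star_mem_solutionSpace h hx

theorem mul_mem_solutionSpace (h : Intertwines α θ u) {m n : ℤ} {x y : CrossedProduct α}
    (hx : x ∈ solutionSpace α θ u m) (hy : y ∈ solutionSpace α θ u n) :
    x * y ∈ solutionSpace α θ u (m + n) := by
  rw [solutionSpace_eq h] at hx hy ⊢
  obtain ⟨⟨a, rfl⟩, hx⟩ := hx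
  obtain ⟨⟨b, rfl⟩, hy⟩ := hy
  exact ⟨⟨_, (monomial_mul_monomial α m n a b).symm⟩,
    (map_mul _ _ _).trans (congrArg₂ (· * ·) hx hy)⟩

theorem solutionSpace_ne_singleton_zero_iff (n : ℤ) :
    solutionSpace α θ u n ≠ {0} ↔ ∃ x ∈ solutionSpace α θ u n, x ≠ 0 := by
  have h0 : (0 : CrossedProduct α) ∈ solutionSpace α θ u n := by
    refine ⟨0, ?_, ?_⟩
    · change _ * θ 0 = 0
      rw [map_zero, mul_zero]
    · change monomial α n 0 = 0
      exact map_zero _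
  constructor
  · intro hne
    by_contra! hall
    exact hne (Set.eq_singleton_iff_unique_mem.2 ⟨h0, hall⟩)
  · rintro ⟨x, hx, hx0⟩ heq
    rw [heq] at hx
    exact hx0 hx

theorem exists_scalar_of_mem_solutionSpace_zero (h : Intertwines α θ u)
    (hθ : IsTopologicallyErgodic θ) {x : CrossedProduct α} (hx : x ∈ solutionSpace α θ u 0) :
    ∃ c : ℂ, x = c • 1 := by
  rw [solutionSpace_eq h] at hx
  obtain ⟨⟨a, rfl⟩, hx⟩ := hx
  have h1 : θ a = a := by
    have := (skewProduct_monomial h 0 a).symm.trans hx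
    simpa [cocycle] using monomial_injective α 0 this
  have h2 : a ∈ fixedPointSet θ := h1
  rw [show fixedPointSet θ = _ from hθ] at h2
  obtain ⟨c, rfl⟩ := h2
  exact ⟨c, by simp [monomial_apply]⟩

theorem exists_addSubgroup_eq (h : Intertwines α θ u) [Nontrivial A]
    (hθ : IsTopologicallyErgodic θ) :
    ∃ G : AddSubgroup ℤ, (G : Set ℤ) = {n : ℤ | solutionSpace α θ u n ≠ {0}} := by
  -- `x*x` has degree `-n + n = 0`, where only scalars occur; the scalar is nonzero by the
  -- C⋆-identity.
  have hsq : ∀ {n : ℤ} {x : CrossedProduct α}, x ∈ solutionSpace α θ u n → x ≠ 0 →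
      ∃ c : ℂ, c ≠ 0 ∧ star x * x = c • 1 := by
    intro n x hx hx0
    have h1 := mul_mem_solutionSpace h (star_mem_solutionSpace h hx) hx
    rw [neg_add_cancel] at h1
    obtain ⟨c, hc⟩ := exists_scalar_of_mem_solutionSpace_zero h hθ h1
    refine ⟨c, ?_, hc⟩
    rintro rfl
    rw [zero_smul] at hc
    exact hx0 ((CStarRing.star_mul_self_eq_zero_iff x).1 hc)
  refine ⟨{ carrier := {n : ℤ | solutionSpace α θ u n ≠ {0}}
            add_mem' := ?_, zero_mem' := ?_, neg_mem' := ?_ }, rfl⟩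
  · intro m n hm hn
    simp only [Set.mem_ofPred_eq, solutionSpace_ne_singleton_zero_iff] at hm hn ⊢
    obtain ⟨x, hx, hx0⟩ := hm
    obtain ⟨y, hy, hy0⟩ := hn
    refine ⟨x * y, mul_mem_solutionSpace h hx hy, fun hxy => hy0 ?_⟩
    obtain ⟨c, hc, hcx⟩ := hsq hx hx0
    have h1 : c • y = 0 := by
      rw [← one_mul y, ← smul_mul_assoc, ← hcx, mul_assoc, hxy, mul_zero]
    exact (smul_eq_zero.1 h1).resolve_left hc
  · rw [Set.mem_ofPred_eq, solutionSpace_ne_singleton_zero_iff]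
    have h1 := one_eq_monomial α
    refine ⟨1, ?_, fun h0 => ?_⟩
    · rw [solutionSpace_eq h]
      exact ⟨⟨1, h1⟩, map_one (skewProduct h)⟩
    · rw [← h1] at h0
      exact one_ne_zero (monomial_injective α 0 (h0.trans (map_zero _).symm))
  · intro n hn
    simp only [Set.mem_ofPred_eq, solutionSpace_ne_singleton_zero_iff] at hn ⊢
    obtain ⟨x, hx, hx0⟩ := hn
    exact ⟨star x, star_mem_solutionSpace h hx, star_ne_zero.2 hx0⟩

end Skew

end CrossedProduct

/-! ### Vector-valued Fourier coefficients -/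

section Fourier

open MeasureTheory AddCircle

variable {B : Type*} [NormedAddCommGroup B] [NormedSpace ℂ B] [CompleteSpace B]

theorem fourierCoeff_clm_comp {E F : Type*} [NormedAddCommGroup E] [NormedSpace ℂ E]
    [CompleteSpace E] [NormedAddCommGroup F] [NormedSpace ℂ F] [CompleteSpace F] (L : E →L[ℂ] F)
    {f : UnitAddCircle → E} (hf : Continuous f) (n : ℤ) :
    fourierCoeff (fun t => L (f t)) n = L (fourierCoeff f n) := by
  have hint : Integrable f haarAddCircle :=
    hf.integrable_of_hasCompactSupport (HasCompactSupport.of_compactSpace f)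
  have := L.integral_comp_comm (hint.fourier_smul (-n))
  simpa only [fourierCoeff, map_smul] using this

/-- A continuous function with all Fourier coefficients in a closed subspace takes values in that
subspace. -/
theorem mem_of_fourierCoeff_mem {M : Submodule ℂ B} (hM : IsClosed (M : Set B))
    {f : UnitAddCircle → B} (hf : Continuous f) (h : ∀ n, fourierCoeff f n ∈ M)
    (t : UnitAddCircle) : f t ∈ M := by
  by_contra ht
  have : IsClosed (M : Set B) := hM
  have hne : M.mkQ (f t) ≠ 0 := by rwa [Ne, Submodule.mkQ_apply, Submodule.Quotient.mk_eq_zero]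
  -- A norming functional on `B ⧸ M` reduces the claim to a scalar function with vanishing Fourier
  -- coefficients, which is zero.
  obtain ⟨g, -, hg⟩ := exists_dual_vector ℂ (M.mkQ (f t)) (norm_ne_zero_iff.2 hne)
  let L : B →L[ℂ] ℂ := g.comp M.mkQL
  have hL : ∀ x ∈ M, L x = 0 := fun x hx => by
    change g (M.mkQ x) = 0
    rw [Submodule.mkQ_apply, (Submodule.Quotient.mk_eq_zero M).2 hx, map_zero]
  let F : C(UnitAddCircle, ℂ) := ⟨fun s => L (f s), L.continuous.comp hf⟩
  have hF : fourierCoeff F = 0 := by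
    ext n
    exact (fourierCoeff_clm_comp L hf n).trans (hL _ (h n))
  have hs := has_pointwise_sum_fourier_series_of_summable (f := F)
    (by rw [hF]; exact summable_zero) t
  simp only [hF, Pi.zero_apply, zero_smul] at hs
  have h0 : L (f t) = 0 := hs.unique hasSum_zero
  have h1 : L (f t) = ‖M.mkQ (f t)‖ := hg
  rw [h0] at h1
  exact hne (norm_eq_zero.1 (by exact_mod_cast h1.symm))

end Fourier

/-! ### The dual action, spectral components and the fixed-point algebra -/

namespace CrossedProduct

open MeasureTheory AddCircle

variable {A : Type v} [CStarAlgebra A] (α : A ≃⋆ₐ[ℂ] A)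

/-- A complex number of modulus one as a scalar unitary. -/
noncomputable def scalarUnitary (A : Type*) [CStarAlgebra A] (z : Circle) : unitary A :=
  ⟨(z : ℂ) • (1 : A), by
    have h1 : star (z : ℂ) * z = 1 := by
      rw [Complex.star_def, Complex.conj_mul', Circle.norm_coe]
      simp
    have h2 : (z : ℂ) * star (z : ℂ) = 1 := by rw [mul_comm, h1]
    rw [Unitary.mem_iff, star_smul, star_one, smul_mul_smul_comm, smul_mul_smul_comm, h1, h2]
    simp⟩

/-- Scalars are central, so the dual action is itself a skew product, with `θ = 1` and `u = z`. -/
theorem intertwines_scalarUnitary (z : Circle) : Intertwines α 1 (scalarUnitary A z) := fun a => by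
  change ((z : ℂ) • (1 : A)) * α a = α a * ((z : ℂ) • (1 : A))
  simp

/-- The dual action `Vⁿ a ↦ zⁿ Vⁿ a`. -/
noncomputable def gauge (z : Circle) : CrossedProduct α ≃⋆ₐ[ℂ] CrossedProduct α :=
  skewProduct (intertwines_scalarUnitary α z)

theorem cocycle_scalarUnitary (z : Circle) (n : ℤ) :
    cocycle α (scalarUnitary A z) n = ((z ^ n : Circle) : ℂ) • (1 : A) := by
  have step : ∀ k : ℤ, cocycle α (scalarUnitary A z) (k + 1) =
      (z : ℂ) • cocycle α (scalarUnitary A z) k := by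
    intro k
    rw [cocycle_add_one]
    change _ * (α ^ k) ((z : ℂ) • (1 : A)) = _
    rw [map_smul, map_one, mul_smul_comm, mul_one]
  induction n with
  | zero => simp [cocycle]
  | succ n ih => rw [step, ih, smul_smul, zpow_add_one, Circle.coe_mul, mul_comm]
  | pred n ih =>
    rw [← sub_add_cancel (-(n : ℤ)) 1, step, zpow_add_one, Circle.coe_mul, mul_comm, mul_smul] at ih
    exact smul_right_injective A (Circle.coe_ne_zero z) ih

theorem gauge_monomial (z : Circle) (n : ℤ) (a : A) :
    gauge α z (monomial α n a) = ((z ^ n : Circle) : ℂ) • monomial α n a := by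
  rw [gauge, skewProduct_monomial, cocycle_scalarUnitary, map_smul, map_one, smul_mul_assoc,
    one_mul, StarAlgEquiv.one_apply, map_smul]

/-- Clear on finite sums; each automorphism of the action is isometric, so approximation of `x` is
uniform in `z`. -/
theorem continuous_gauge (x : CrossedProduct α) : Continuous fun z => gauge α z x := by
  have hspan : ∀ y ∈ Submodule.span ℂ {x | ∃ n a, monomial α n a = x},
      Continuous fun z => gauge α z y := by
    intro y hy
    induction hy using Submodule.span_induction with
    | mem y hy =>
      obtain ⟨n, a, rfl⟩ := hy
      simp only [gauge_monomial]
      exact (continuous_subtype_val.comp (continuous_zpow (G := Circle) n)).smul continuous_const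
    | zero => simpa only [map_zero] using continuous_const
    | add y z _ _ hy hz => simp only [map_add]; exact hy.add hz
    | smul c y _ hy => simp only [map_smul]; exact hy.const_smul c
  refine continuous_of_uniform_approx_of_continuous fun s hs => ?_
  obtain ⟨ε, hε, hεs⟩ := Metric.mem_uniformity_dist.1 hs
  obtain ⟨y, hy, hxy⟩ := Metric.mem_closure_iff.1 (mem_closure_span_monomials α x) ε hε
  refine ⟨fun z => gauge α z y, hspan y hy, fun z => hεs ?_⟩
  rwa [(StarAlgEquiv.isometry (gauge α z)).dist_eq]

theorem continuous_gauge_toCircle (x : CrossedProduct α) :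
    Continuous fun t : UnitAddCircle => gauge α t.toCircle x :=
  (continuous_gauge α x).comp continuous_toCircle

/-- The `n`-th spectral component of an element for the dual action. -/
noncomputable def component (n : ℤ) : CrossedProduct α →L[ℂ] CrossedProduct α :=
  LinearMap.mkContinuous
    { toFun := fun x => fourierCoeff (fun t : UnitAddCircle => gauge α t.toCircle x) n
      map_add' := fun x y => by
        have hint : ∀ x, Integrable (fun t : UnitAddCircle => gauge α t.toCircle x) haarAddCircle :=
          fun x => (continuous_gauge_toCircle α x).integrable_of_hasCompactSupport
            (HasCompactSupport.of_compactSpace _)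
        rw [← Pi.add_apply (fourierCoeff _), ← fourierCoeff.add (hint x) (hint y)]
        simp only [map_add]
        rfl
      map_smul' := fun c x => by
        rw [RingHom.id_apply, ← fourierCoeff.const_smul]
        simp only [map_smul]
        rfl } 1 fun x => by
    rw [one_mul]
    refine (norm_integral_le_of_norm_le_const (C := ‖x‖) (.of_forall fun t => ?_)).trans_eq ?_
    · rw [norm_smul, fourier_apply, Circle.norm_coe, one_mul, StarAlgEquiv.norm_map]
    · simp

theorem component_apply (n : ℤ) (x : CrossedProduct α) :
    component α n x = fourierCoeff (fun t : UnitAddCircle => gauge α t.toCircle x) n := rfl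

theorem component_monomial (k n : ℤ) (a : A) :
    component α k (monomial α n a) = (Pi.single n 1 : ℤ → ℂ) k • monomial α n a := by
  have h : (fun t : UnitAddCircle => gauge α t.toCircle (monomial α n a)) = fun t =>
      ContinuousLinearMap.toSpanSingleton ℂ (monomial α n a) (fourier n t) := by
    ext1 t
    rw [gauge_monomial, ContinuousLinearMap.toSpanSingleton_apply, fourier_apply, toCircle_zsmul]
  rw [component_apply, h]
  refine (fourierCoeff_clm_comp _ (fourier n).continuous k).trans ?_
  rw [fourierCoeff_fourier]
  rfl

/-- By orthogonality of characters the component keeps only the degree `k` term of a finite sum;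
density and closedness of `VᵏA` do the rest. -/
theorem component_mem_range (k : ℤ) (x : CrossedProduct α) :
    component α k x ∈ Set.range (monomial α k) := by
  refine closure_minimal (t := component α k ⁻¹' Set.range (monomial α k)) (fun y hy => ?_)
    ((isClosed_range_monomial α k).preimage (component α k).continuous)
    (mem_closure_span_monomials α x)
  change component α k y ∈ LinearMap.range (monomial α k)
  induction hy using Submodule.span_induction with
  | mem y hy =>
    obtain ⟨n, a, rfl⟩ := hy
    rw [component_monomial]
    by_cases hkn : k = n
    · subst hkn
      exact Submodule.smul_mem _ _ ⟨a, rfl⟩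
    · rw [Pi.single_eq_of_ne hkn, zero_smul]
      exact zero_mem _
  | zero => rw [map_zero]; exact zero_mem _
  | add y z _ _ hy hz => rw [map_add]; exact add_mem hy hz
  | smul c y _ hy => rw [map_smul]; exact Submodule.smul_mem _ c hy

theorem mem_of_component_mem {M : Submodule ℂ (CrossedProduct α)}
    (hM : IsClosed (M : Set (CrossedProduct α))) {x : CrossedProduct α}
    (h : ∀ k, component α k x ∈ M) : x ∈ M := by
  -- The orbit at `t = 0` is `x` itself, since `z = 1` acts trivially.
  have h0 := mem_of_fourierCoeff_mem hM (continuous_gauge_toCircle α x) h 0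
  have h1 : gauge α 1 x = x := by
    have hcl : IsClosed {y | gauge α 1 y = y} :=
      isClosed_eq (StarAlgEquiv.isometry (gauge α 1)).continuous continuous_id
    refine closure_minimal (fun y hy => ?_) hcl (mem_closure_span_monomials α x)
    change gauge α 1 y = y
    induction hy using Submodule.span_induction with
    | mem y hy =>
      obtain ⟨n, a, rfl⟩ := hy
      rw [gauge_monomial, one_zpow, Circle.coe_one, one_smul]
    | zero => rw [map_zero]
    | add y z _ _ hy hz => rw [map_add, hy, hz]
    | smul c y _ hy => rw [map_smul, hy]
  rwa [toCircle_zero, h1] at h0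

variable {α} {θ : A ≃⋆ₐ[ℂ] A} {u : unitary A}

theorem skewProduct_gauge (h : Intertwines α θ u) (z : Circle) (x : CrossedProduct α) :
    skewProduct h (gauge α z x) = gauge α z (skewProduct h x) := by
  have hcl : IsClosed {y | skewProduct h (gauge α z y) = gauge α z (skewProduct h y)} :=
    isClosed_eq
      ((StarAlgEquiv.isometry _).continuous.comp (StarAlgEquiv.isometry (gauge α z)).continuous)
      ((StarAlgEquiv.isometry _).continuous.comp (StarAlgEquiv.isometry (skewProduct h)).continuous)
  refine closure_minimal (fun y hy => ?_) hcl (mem_closure_span_monomials α x)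
  change skewProduct h (gauge α z y) = gauge α z (skewProduct h y)
  induction hy using Submodule.span_induction with
  | mem y hy =>
    obtain ⟨n, a, rfl⟩ := hy
    rw [gauge_monomial, map_smul, skewProduct_monomial, gauge_monomial]
  | zero => simp only [map_zero]
  | add y z _ _ hy hz => simp only [map_add, hy, hz]
  | smul c y _ hy => simp only [map_smul, hy]

/-- `Φ` is continuous and linear, so it passes through the Fourier integral, and it commutes with
the dual action. -/
theorem skewProduct_component (h : Intertwines α θ u) (k : ℤ) (x : CrossedProduct α) :
    skewProduct h (component α k x) = component α k (skewProduct h x) := by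
  let L : CrossedProduct α →L[ℂ] CrossedProduct α :=
    ⟨(skewProduct h : CrossedProduct α →ₗ[ℂ] CrossedProduct α),
      (StarAlgEquiv.isometry (skewProduct h)).continuous⟩
  have := fourierCoeff_clm_comp L (continuous_gauge_toCircle α x) k
  refine this.symm.trans ?_
  rw [component_apply]
  congr 1
  exact funext fun t => skewProduct_gauge h _ x

theorem fixedPointSet_skewProduct (h : Intertwines α θ u) :
    fixedPointSet (skewProduct h) =
      closure (Submodule.span ℂ (⋃ n : ℤ, solutionSpace α θ u n) : Set (CrossedProduct α)) := by
  refine Set.Subset.antisymm (fun x hx => ?_) (closure_minimal (fun x hx => ?_) ?_)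
  · rw [← Submodule.topologicalClosure_coe]
    refine mem_of_component_mem α (Submodule.isClosed_topologicalClosure _) fun k => ?_
    refine Submodule.le_topologicalClosure _ (Submodule.subset_span (Set.mem_iUnion.2 ⟨k, ?_⟩))
    rw [solutionSpace_eq h]
    exact ⟨component_mem_range α k x,
      (skewProduct_component h k x).trans (congrArg (component α k) hx)⟩
  · change skewProduct h x = x
    induction hx using Submodule.span_induction with
    | mem y hy =>
      obtain ⟨n, hn⟩ := Set.mem_iUnion.1 hy
      rw [solutionSpace_eq h] at hn
      exact hn.2
    | zero => rw [map_zero]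
    | add y z _ _ hy hz => rw [map_add, hy, hz]
    | smul c y _ hy => rw [map_smul, hy]
  · exact isClosed_eq (StarAlgEquiv.isometry (skewProduct h)).continuous continuous_id

end CrossedProduct

theorem mainTheorem11 {A : Type v} [CStarAlgebra A] (α θ : A ≃⋆ₐ[ℂ] A) (u : unitary A)
    (h : Intertwines α θ u) :
    (∀ m : ℤ, star (solutionSpace α θ u m) = solutionSpace α θ u (-m)) ∧
    (∀ m n : ℤ, solutionSpace α θ u m * solutionSpace α θ u n ⊆ solutionSpace α θ u (m + n)) ∧
    (fixedPointSet (CrossedProduct.skewProduct h) =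
      closure (Submodule.span ℂ (⋃ n : ℤ, solutionSpace α θ u n) : Set (CrossedProduct α))) ∧
    (Nontrivial A → IsTopologicallyErgodic θ →
      ∃ G : AddSubgroup ℤ, (G : Set ℤ) = {n : ℤ | solutionSpace α θ u n ≠ {0}}) ∧
    (IsUniquelyErgodic θ → IsTopologicallyErgodic θ) := by
  refine ⟨CrossedProduct.star_solutionSpace h, fun m n => ?_,
    CrossedProduct.fixedPointSet_skewProduct h,
    fun _ hθ => CrossedProduct.exists_addSubgroup_eq h hθ,
    IsUniquelyErgodic.isTopologicallyErgodic⟩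
  rintro _ ⟨x, hx, y, hy, rfl⟩
  exact CrossedProduct.mul_mem_solutionSpace h hx hy
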